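/- Let $a\in(0,\infty]$ and let $F:[0,a)\to[-\infty,\infty)$ be admissible, that is, $F$ is continuous on $(0,a)$, strictly increasing on $[0,a)$, and $F(0)=-\infty$. A function $f:\mathbb R^n\to[0,a)$ is called $F$-concave on $\mathbb R^n$ if $$F\big(f((1-\lambda)x+\lambda y)\big)\ \ge\ (1-\lambda)F(f(x))+\lambda F(f(y))\qquad\text{for all }x,y\in\mathbb R^n,\ \lambda\in(0,1),$$ with the conventions $\kappa\cdot(-\infty)=-\infty$ for $\kappa>0$ and $-\infty+b=b-\infty=-\infty$ for $b\in[-\infty,\infty)$. A function $f:\mathbb R^n\to[0,\infty)$ is log-concave if it is $F$-concave for $F=\log$ on $[0,\infty)$, with $\log 0=-\infty$. A function $u:\mathbb R^n\to\mathbb R$ is quasi-concave if the sets $\{x: u(x)\ge r\}$, $r\in\mathbb R$, are all convex. Let $n\ge 2$, and assume that there is an $F$-concave function on $\mathbb R^n$ that is not log-concave. Then there is a bounded, (Lebesgue) measurable, $F$-concave function $\varphi:\mathbb R^n\to[0,a)$ and a number $T>0$ such that, for every $t\in(0,T)$, the function $$(e^{t\Delta}\varphi)(x)=(4\pi t)^{-n/2}\int_{\mathbb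 R^n}e^{-|x-y|^2/(4t)}\,\varphi(y)\,dy,\qquad x\in\mathbb R^n,$$ is not quasi-concave on $\mathbb R^n$. -/

import Mathlib

open MeasureTheory Set Filter Topology

noncomputable section

/-- The interval `[0, a)` of real numbers, where `a` may be `⊤`, i.e. `∞`. -/
def admInterval (a : EReal) : Set ℝ := {r : ℝ | 0 ≤ r ∧ (r : EReal) < a}

/-- `F : [0, a) → [-∞, ∞)` is admissible: it is continuous on `(0, a)`, strictly increasing on
`[0, a)`, and `F 0 = -∞`. The values of `F` outside `[0, a)` play no role. -/
structure IsAdmissible (a : EReal) (F : ℝ → EReal) : Prop where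
  ne_top : ∀ r ∈ admInterval a, F r ≠ ⊤
  continuousOn : ContinuousOn F (admInterval a \ {0})
  strictMonoOn : StrictMonoOn F (admInterval a)
  map_zero : F 0 = ⊥

/-- `f` takes its values on `Ω` in `[0, a)` and is `F`-concave in `Ω`. For values of `F` in
`[-∞, ∞)` the arithmetic of `EReal` follows the usual conventions `κ * (-∞) = -∞` for `κ > 0` and
`-∞ + b = b + -∞ = -∞`. -/
structure IsFConcaveOn {E : Type*} [AddCommGroup E] [Module ℝ E]
    (a : EReal) (F : ℝ → EReal) (Ω : Set E) (f : E → ℝ) : Prop where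
  mapsTo : MapsTo f Ω (admInterval a)
  concave : ∀ x ∈ Ω, ∀ y ∈ Ω, ∀ lam : ℝ, 0 < lam → lam < 1 →
    ((1 - lam : ℝ) : EReal) * F (f x) + (lam : EReal) * F (f y)
      ≤ F (f ((1 - lam) • x + lam • y))

/-- The admissible function `log` on `[0, ∞)`, with `log 0 = -∞`. -/
def admLog (r : ℝ) : EReal := if r = 0 then ⊥ else (Real.log r : EReal)

/-- A nonnegative function `f` is log-concave in `Ω`. -/
def IsLogConcaveOn {E : Type*} [AddCommGroup E] [Module ℝ E] (Ω : Set E) (f : E → ℝ) : Prop :=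
  IsFConcaveOn ⊤ admLog Ω f

/-- The Gaussian heat flow `(e^{tΔ} φ)(x) = (4πt)^{-n/2} ∫ exp(-|x-y|²/(4t)) φ(y) dy` on `ℝⁿ`. -/
def heatFlow (n : ℕ) (t : ℝ) (φ : EuclideanSpace ℝ (Fin n) → ℝ)
    (x : EuclideanSpace ℝ (Fin n)) : ℝ :=
  (4 * Real.pi * t) ^ (-(n : ℝ) / 2) * ∫ y, Real.exp (-‖x - y‖ ^ 2 / (4 * t)) * φ y

end

/-! The datum is a product `h (x i) * k (x j)`: `h` is a profile `w` cut off to `[0, ∞)`, with `F ∘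
w` affine up to a cap, and `k` is the indicator of `(-∞, 0]`. The failure of log-concavity lets `w`
violate the log-concavity inequality at three points, and the flow of `h` inherits this violation
for small `t`. Log-concavity is stronger than quasi-concavity, and the second factor closes the gap.
Far from the half-line its flow at `L + s / L` is asymptotically a constant depending on `L` times
`exp (-s / (2 * t))`. A suitable `s` at each endpoint equalizes the two products there, and the
violation then makes the product strictly smaller in between. Hence a superlevel set is not convex.
-/

/-! ### Gaussian tails of a half-line -/

/-- Substituting `y = -w / L` turns the squared distance into `L² + 2(s + w) + (s + w)² / L²`. The
prefactors cancel the Jacobian and the `L²` term, and the last term vanishes in the limit. -/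
theorem tendsto_gaussian_tail {t : ℝ} (ht : 0 < t) (s : ℝ) :
    Tendsto (fun L : ℝ => L * Real.exp (L ^ 2 / (4 * t)) *
        ∫ y in Iic (0 : ℝ), Real.exp (-(L + s / L - y) ^ 2 / (4 * t))) atTop
      (𝓝 (2 * t * Real.exp (-s / (2 * t)))) := by
  have hlim : ∫ w in Ioi (0 : ℝ), Real.exp (-(s + w) / (2 * t)) =
      2 * t * Real.exp (-s / (2 * t)) := by
    have h1 : ∀ w : ℝ, Real.exp (-(s + w) / (2 * t)) =
        Real.exp (-s / (2 * t)) * Real.exp (-(2 * t)⁻¹ * w) := fun w => by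
      rw [← Real.exp_add]; congr 1; field_simp; ring
    simp_rw [h1]
    rw [integral_const_mul, integral_exp_mul_Ioi (by simpa using ht)]
    simp; ring
  have hint : IntegrableOn (fun w : ℝ => Real.exp (-(s + w) / (2 * t))) (Ioi 0) := by
    -- A non-integrable function would have integral `0`, but the value found above is positive.
    by_contra h
    have := integral_undef h
    rw [hlim] at this
    have : 0 < 2 * t * Real.exp (-s / (2 * t)) := by positivity
    linarith
  rw [← hlim]
  have key : Tendsto (fun L : ℝ => ∫ w in Ioi (0 : ℝ),
      Real.exp (-(s + w) / (2 * t) - (s + w) ^ 2 / L ^ 2 / (4 * t))) atTop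
      (𝓝 (∫ w in Ioi (0 : ℝ), Real.exp (-(s + w) / (2 * t)))) := by
    refine tendsto_integral_filter_of_dominated_convergence _ ?_ ?_ hint ?_
    · exact Eventually.of_forall fun L => (by fun_prop : Measurable _).aestronglyMeasurable
    · refine Eventually.of_forall fun L => Eventually.of_forall fun w => ?_
      rw [Real.norm_eq_abs, Real.abs_exp]
      apply Real.exp_le_exp.2
      have : 0 ≤ (s + w) ^ 2 / L ^ 2 / (4 * t) := by positivity
      linarith
    · refine Eventually.of_forall fun w => ?_
      have h2 : Tendsto (fun L : ℝ => (s + w) ^ 2 / L ^ 2 / (4 * t)) atTop (𝓝 (0 / (4 * t))) :=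
        ((tendsto_pow_atTop two_ne_zero).const_div_atTop _).div_const _
      have := (Real.continuous_exp.tendsto _).comp (h2.const_sub (-(s + w) / (2 * t)))
      simpa [Function.comp_def] using this
  refine key.congr' ?_
  filter_upwards [eventually_gt_atTop 0] with L hL
  have h3 : ∫ y in Iic (0 : ℝ), Real.exp (-(L + s / L - y) ^ 2 / (4 * t)) =
      ∫ y in Ioi (0 : ℝ), Real.exp (-(L + s / L + y) ^ 2 / (4 * t)) := by
    have := integral_comp_neg_Ioi 0 (fun y : ℝ => Real.exp (-(L + s / L - y) ^ 2 / (4 * t)))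
    simpa using this.symm
  have h4 := integral_comp_mul_left_Ioi
    (fun y : ℝ => Real.exp (-(L + s / L + y) ^ 2 / (4 * t))) 0 (inv_pos.2 hL)
  rw [mul_zero, inv_inv, smul_eq_mul] at h4
  rw [h3, mul_right_comm, ← h4, mul_comm (integral _ _), ← integral_const_mul]
  congr 1
  ext w
  rw [← Real.exp_add]
  congr 1
  field_simp
  ring

/-- If `V` violates log-concavity, then `V` times the heat flow of a half-line is not
quasi-concave. -/
theorem exists_gaussian_tail_violation {t : ℝ} (ht : 0 < t) {l v₀ v₁ v : ℝ}
    (h₀ : 0 < v₀) (h₁ : 0 < v₁) (h : v < v₀ ^ (1 - l) * v₁ ^ l) :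
    ∃ z₀ z₁ r : ℝ,
      r ≤ v₀ * ∫ y in Iic (0 : ℝ), Real.exp (-(z₀ - y) ^ 2 / (4 * t)) ∧
      r ≤ v₁ * ∫ y in Iic (0 : ℝ), Real.exp (-(z₁ - y) ^ 2 / (4 * t)) ∧
      v * (∫ y in Iic (0 : ℝ), Real.exp (-((1 - l) * z₀ + l * z₁ - y) ^ 2 / (4 * t))) < r := by
  -- These shifts make both endpoint limits equal to `2 * t`, while the limit at the intermediate
  -- point is strictly smaller.
  set α := 2 * t * Real.log v₀ with hα
  set β := 2 * t * Real.log v₁ with hβ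
  have e₀ : v₀ * (2 * t * Real.exp (-α / (2 * t))) = 2 * t := by
    rw [hα, show -(2 * t * Real.log v₀) / (2 * t) = -Real.log v₀ by field_simp,
      Real.exp_neg, Real.exp_log h₀]
    field_simp
  have e₁ : v₁ * (2 * t * Real.exp (-β / (2 * t))) = 2 * t := by
    rw [hβ, show -(2 * t * Real.log v₁) / (2 * t) = -Real.log v₁ by field_simp,
      Real.exp_neg, Real.exp_log h₁]
    field_simp
  have e : v * (2 * t * Real.exp (-((1 - l) * α + l * β) / (2 * t))) < 2 * t := by
    rw [hα, hβ, show -((1 - l) * (2 * t * Real.log v₀) + l * (2 * t * Real.log v₁)) / (2 * t) =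
      -(Real.log v₀ * (1 - l) + Real.log v₁ * l) by field_simp,
      Real.exp_neg, Real.exp_add, ← Real.rpow_def_of_pos h₀, ← Real.rpow_def_of_pos h₁]
    have : 0 < v₀ ^ (1 - l) * v₁ ^ l := by positivity
    rw [← div_eq_mul_inv, mul_div_assoc', div_lt_iff₀ this]
    nlinarith
  obtain ⟨c, hc, hc'⟩ := exists_between e
  have T₀ := (tendsto_gaussian_tail ht α).const_mul v₀
  have T₁ := (tendsto_gaussian_tail ht β).const_mul v₁
  have T := (tendsto_gaussian_tail ht ((1 - l) * α + l * β)).const_mul v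
  rw [e₀] at T₀
  rw [e₁] at T₁
  obtain ⟨L, ⟨⟨⟨a₀, a₁⟩, a₂⟩, hL⟩⟩ := ((((T₀.eventually_const_lt hc').and
    (T₁.eventually_const_lt hc')).and (T.eventually_lt_const hc)).and
    (eventually_gt_atTop 0)).exists
  have hpos : 0 < L * Real.exp (L ^ 2 / (4 * t)) := by positivity
  refine ⟨L + α / L, L + β / L, c / (L * Real.exp (L ^ 2 / (4 * t))), ?_, ?_, ?_⟩
  · rw [div_le_iff₀ hpos]; linarith
  · rw [div_le_iff₀ hpos]; linarith
  · rw [lt_div_iff₀ hpos,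
      show (1 - l) * (L + α / L) + l * (L + β / L) = L + ((1 - l) * α + l * β) / L by ring]
    linarith

/-! ### Heat flow on the line and of product data -/

/-- The heat flow on the line converges to a bounded datum at its points of continuity. -/
theorem tendsto_heat_line {h : ℝ → ℝ} (hm : Measurable h) {M : ℝ} (hM : ∀ x, |h x| ≤ M) {s : ℝ}
    (hs : ContinuousAt h s) :
    Tendsto (fun t : ℝ => (2 * √t)⁻¹ * ∫ y, Real.exp (-(s - y) ^ 2 / (4 * t)) * h y) (𝓝[>] 0)
      (𝓝 (√Real.pi * h s)) := by
  have hlim : ∫ v : ℝ, Real.exp (-1 * v ^ 2) * h s = √Real.pi * h s := by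
    rw [integral_mul_const, integral_gaussian, div_one]
  rw [← hlim]
  -- Rescaling by `y = s - 2 * √t * v` moves `t` from the kernel into the argument of `h`.
  have key : Tendsto (fun t : ℝ => ∫ v : ℝ, Real.exp (-1 * v ^ 2) * h (s - 2 * √t * v)) (𝓝[>] 0)
      (𝓝 (∫ v : ℝ, Real.exp (-1 * v ^ 2) * h s)) := by
    refine tendsto_integral_filter_of_dominated_convergence
      (fun v => Real.exp (-1 * v ^ 2) * M) ?_ ?_ ?_ ?_
    · exact Eventually.of_forall fun L => (by fun_prop : Measurable _).aestronglyMeasurable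
    · refine Eventually.of_forall fun L => Eventually.of_forall fun w => ?_
      rw [norm_mul, Real.norm_eq_abs, Real.abs_exp, Real.norm_eq_abs]
      gcongr
      exact hM _
    · exact (integrable_exp_neg_mul_sq one_pos).mul_const _
    · refine Eventually.of_forall fun v => Tendsto.const_mul _ ?_
      refine hs.tendsto.comp ?_
      have : Continuous fun t : ℝ => s - 2 * √t * v := by fun_prop
      have := this.tendsto 0
      simp only [Real.sqrt_zero, mul_zero, zero_mul, sub_zero] at this
      exact this.mono_left nhdsWithin_le_nhds
  refine key.congr' ?_
  filter_upwards [self_mem_nhdsWithin] with t (ht : 0 < t)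
  have hq : 0 < √t := Real.sqrt_pos.2 ht
  have h1 := Measure.integral_comp_mul_left
    (fun y : ℝ => Real.exp (-y ^ 2 / (4 * t)) * h (s - y)) (2 * √t)
  have h2 := integral_sub_left_eq_self
    (fun y : ℝ => Real.exp (-(s - y) ^ 2 / (4 * t)) * h y) volume s
  simp only [sub_sub_cancel] at h2
  rw [h2, smul_eq_mul, abs_of_pos (by positivity)] at h1
  rw [← h1]
  congr 1
  ext v
  congr 2
  rw [mul_pow, mul_pow, Real.sq_sqrt ht.le]
  field_simp
  ring

theorem heatFlow_two_factors {n : ℕ} {i j : Fin n} (hij : i ≠ j) (t : ℝ) (h k : ℝ → ℝ)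
    (x : EuclideanSpace ℝ (Fin n)) :
    heatFlow n t (fun y => h (y i) * k (y j)) x =
      (4 * Real.pi * t) ^ (-(n : ℝ) / 2) *
      ((∫ y, Real.exp (-(x i - y) ^ 2 / (4 * t)) * h y) *
        (∫ y, Real.exp (-(x j - y) ^ 2 / (4 * t)) * k y) *
        ∏ m ∈ (Finset.univ.erase i).erase j, ∫ y, Real.exp (-(x m - y) ^ 2 / (4 * t))) := by
  unfold heatFlow
  congr 1
  let g : Fin n → ℝ → ℝ := fun m y => Real.exp (-(x m - y) ^ 2 / (4 * t)) *
    if m = i then h y else if m = j then k y else 1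
  have split : ∀ f : Fin n → ℝ,
      ∏ m, f m = f i * f j * ∏ m ∈ (Finset.univ.erase i).erase j, f m := fun f => by
    rw [mul_assoc, Finset.mul_prod_erase _ f (by simp [hij.symm]),
      Finset.mul_prod_erase _ f (Finset.mem_univ i)]
  have h1 : ∀ y : EuclideanSpace ℝ (Fin n),
      Real.exp (-‖x - y‖ ^ 2 / (4 * t)) * (h (y i) * k (y j)) = ∏ m, g m (y m) := fun y => by
    simp only [g]
    rw [Finset.prod_mul_distrib, ← Real.exp_sum, split (fun m => if m = i then _ else _)]
    rw [Finset.prod_eq_one (s := (Finset.univ.erase i).erase j)]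
    · simp [hij.symm, EuclideanSpace.norm_sq_eq, ← Finset.sum_div]
    · intro m hm
      simp only [Finset.mem_erase] at hm
      simp [hm.1, hm.2.1]
  simp_rw [h1]
  rw [← (PiLp.volume_preserving_toLp (Fin n)).integral_comp
    (MeasurableEquiv.toLp 2 _).measurableEmbedding]
  rw [integral_fintype_prod_volume_eq_prod g, split]
  congr 1
  · simp [g, hij.symm]
  · refine Finset.prod_congr rfl fun m hm => ?_
    simp only [Finset.mem_erase] at hm
    simp [g, hm.1, hm.2.1]

/-! ### Profiles adapted to `F` -/

theorem IsAdmissible.ne_bot {a : EReal} {F : ℝ → EReal} (hF : IsAdmissible a F) {p : ℝ}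
    (hp : p ∈ admInterval a) (h0 : 0 < p) : F p ≠ ⊥ := by
  have h : (0 : ℝ) ∈ admInterval a :=
    ⟨le_rfl, lt_of_le_of_lt (EReal.coe_le_coe_iff.2 h0.le) hp.2⟩
  have := hF.strictMonoOn h hp h0
  rw [hF.map_zero] at this
  exact this.ne'

theorem IsAdmissible.coe_toReal {a : EReal} {F : ℝ → EReal} (hF : IsAdmissible a F) {p : ℝ}
    (hp : p ∈ admInterval a) (h0 : 0 < p) : ((F p).toReal : EReal) = F p :=
  EReal.coe_toReal (hF.ne_top p hp) (hF.ne_bot hp h0)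

theorem mem_admInterval_of_le {a : EReal} {p q : ℝ} (hq : q ∈ admInterval a) (h0 : 0 ≤ p)
    (h : p ≤ q) : p ∈ admInterval a :=
  ⟨h0, lt_of_le_of_lt (EReal.coe_le_coe_iff.2 h) hq.2⟩

/-- The inverse image under `F` of an affine function truncated to `[F p, F q]`. -/
theorem IsAdmissible.exists_profile {a : EReal} {F : ℝ → EReal} (hF : IsAdmissible a F)
    {p q : ℝ} (hp : 0 < p) (hpq : p < q) (hq : q ∈ admInterval a) :
    ∃ w : ℝ → ℝ, Continuous w ∧ (∀ s, p ≤ w s ∧ w s ≤ q) ∧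
      ∀ s, F (w s) = ((max (F p).toReal (min (F q).toReal
        ((F p).toReal + s * ((F q).toReal - (F p).toReal))) : ℝ) : EReal) := by
  have hmem : ∀ x ∈ Icc p q, x ∈ admInterval a := fun x hx =>
    mem_admInterval_of_le hq (hp.le.trans hx.1) hx.2
  set G : ℝ → ℝ := fun x => (F x).toReal with hG
  have hcoe : ∀ x ∈ Icc p q, (G x : EReal) = F x := fun x hx =>
    hF.coe_toReal (hmem x hx) (hp.trans_le hx.1)
  have hmono : StrictMonoOn G (Icc p q) := fun x hx y hy hxy => by
    rw [← EReal.coe_lt_coe_iff, hcoe x hx, hcoe y hy]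
    exact hF.strictMonoOn (hmem x hx) (hmem y hy) hxy
  have hcont : ContinuousOn G (Icc p q) := by
    intro x hx
    refine (EReal.tendsto_toReal (hF.ne_top x (hmem x hx))
      (hF.ne_bot (hmem x hx) (hp.trans_le hx.1))).comp ?_
    exact ((hF.continuousOn x ⟨hmem x hx, (hp.trans_le hx.1).ne'⟩).mono
      fun y hy => ⟨hmem y hy, (hp.trans_le hy.1).ne'⟩)
  have himg : G '' Icc p q = Icc (G p) (G q) :=
    (hmono.monotoneOn.image_Icc_subset).antisymm (intermediate_value_Icc hpq.le hcont)
  have hAB : G p ≤ G q := (hmono (left_mem_Icc.2 hpq.le) (right_mem_Icc.2 hpq.le) hpq).le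
  -- An order isomorphism of intervals has a continuous inverse, which gives continuity of the
  -- profile.
  let e : Icc p q ≃o Icc (G p) (G q) :=
    (hmono.orderIso G (Icc p q)).trans (OrderIso.setCongr _ _ himg)
  have he : ∀ x, ((e x : Icc (G p) (G q)) : ℝ) = G x := fun x => rfl
  refine ⟨fun s => (e.symm (projIcc (G p) (G q) hAB (G p + s * (G q - G p))) : ℝ), ?_, ?_, ?_⟩
  · exact continuous_subtype_val.comp (e.symm.continuous.comp
      (continuous_projIcc.comp (by fun_prop)))
  · exact fun s => (e.symm _).2
  · intro s
    rw [← hcoe _ (e.symm _).2, ← he, e.apply_symm_apply]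
    rfl

/-- The witness to the failure of log-concavity, in terms of the values of `F` only. -/
theorem IsAdmissible.exists_log_violation {E : Type*} [AddCommGroup E] [Module ℝ E]
    {a : EReal} {F : ℝ → EReal} (hF : IsAdmissible a F) {f : E → ℝ}
    (hf : IsFConcaveOn a F univ f) (hlog : ¬ IsLogConcaveOn univ f) :
    ∃ p q l : ℝ, 0 < p ∧ p < q ∧ q ∈ admInterval a ∧ 0 < l ∧ l < 1 ∧
      ∀ w ∈ admInterval a, F w = (((1 - l) * (F p).toReal + l * (F q).toReal : ℝ) : EReal) →
        w < p ^ (1 - l) * q ^ l := by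
  have hmem : ∀ x, f x ∈ admInterval a := fun x => hf.mapsTo (mem_univ x)
  obtain ⟨x, y, l, hl0, hl1, h⟩ : ∃ x y : E, ∃ l : ℝ, 0 < l ∧ l < 1 ∧
      admLog (f ((1 - l) • x + l • y)) <
        ((1 - l : ℝ) : EReal) * admLog (f x) + (l : EReal) * admLog (f y) := by
    by_contra! hcon
    exact hlog ⟨fun x _ => ⟨(hmem x).1, EReal.coe_lt_top _⟩,
      fun x _ y _ l h0 h1 => hcon x y l h0 h1⟩
  have hl1' : 0 < 1 - l := sub_pos.2 hl1
  have hx : 0 < f x := by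
    refine (hmem x).1.lt_of_ne fun h0 => ?_
    rw [← h0, admLog, admLog, if_pos rfl, EReal.coe_mul_bot_of_pos hl1', EReal.bot_add] at h
    exact not_lt_bot h
  have hy : 0 < f y := by
    refine (hmem y).1.lt_of_ne fun h0 => ?_
    simp [admLog, ← h0, EReal.coe_mul_bot_of_pos hl0] at h
  set r := f ((1 - l) • x + l • y) with hr
  have hc := hf.concave x (mem_univ _) y (mem_univ _) l hl0 hl1
  rw [← hr] at hc
  rw [← hF.coe_toReal (hmem x) hx, ← hF.coe_toReal (hmem y) hy] at hc
  norm_cast at hc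
  have hr0 : 0 < r := by
    refine (hmem _).1.lt_of_ne fun h0 => ?_
    rw [← hr] at h0
    rw [← h0, hF.map_zero] at hc
    exact absurd (le_bot_iff.1 hc) (EReal.coe_ne_bot _)
  have hlt : r < f x ^ (1 - l) * f y ^ l := by
    simp only [admLog, hx.ne', hy.ne', hr0.ne', if_false] at h
    norm_cast at h
    rw [Real.rpow_def_of_pos hx, Real.rpow_def_of_pos hy, ← Real.exp_add,
      ← Real.log_lt_iff_lt_exp hr0]
    linarith
  have hw : ∀ w ∈ admInterval a,
      F w = (((1 - l) * (F (f x)).toReal + l * (F (f y)).toReal : ℝ) : EReal) →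
        w < f x ^ (1 - l) * f y ^ l := fun w hw hFw => by
    rw [← hFw] at hc
    exact ((hF.strictMonoOn.le_iff_le hw (hmem _)).1 hc).trans_lt hlt
  rcases lt_trichotomy (f x) (f y) with hxy | hxy | hxy
  · exact ⟨f x, f y, l, hx, hxy, hmem y, hl0, hl1, hw⟩
  -- Equal endpoint values would give `f x < f x`.
  · have := hw (f x) (hmem x) (by
      rw [← hxy, ← hF.coe_toReal (hmem x) hx]; congr 1; simp; ring)
    rw [← hxy, ← Real.rpow_add hx, sub_add_cancel, Real.rpow_one] at this
    exact absurd this (lt_irrefl _)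
  · refine ⟨f y, f x, 1 - l, hy, hxy, hmem x, hl1', by linarith, fun w hw' hFw => ?_⟩
    rw [sub_sub_cancel, mul_comm]
    refine hw w hw' ?_
    rw [hFw, sub_sub_cancel, add_comm]

/-- On the quadrant `0 ≤ X`, `Y ≤ 0` the lower truncation is inactive, so `F` of the product is a
minimum of a constant and an affine function, hence concave. Off this convex set the value is `0`,
where `F` is `⊥`. -/
theorem isFConcaveOn_profile {a : EReal} {F : ℝ → EReal} (hF : IsAdmissible a F)
    {E : Type*} [AddCommGroup E] [Module ℝ E] {A B q : ℝ} (hq : q ∈ admInterval a) (hAB : A ≤ B)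
    {w : ℝ → ℝ} (hw : ∀ s, 0 ≤ w s ∧ w s ≤ q)
    (hFw : ∀ s, F (w s) = ((max A (min B (A + s * (B - A))) : ℝ) : EReal)) (X Y : E →ₗ[ℝ] ℝ) :
    IsFConcaveOn a F univ fun x =>
      (Ici (0 : ℝ)).indicator w (X x) * (Iic (0 : ℝ)).indicator 1 (Y x) := by
  have hv : ∀ s, 0 ≤ s → F (w s) = ((min B (A + s * (B - A)) : ℝ) : EReal) := fun s hs => by
    rw [hFw, max_eq_right (le_min hAB (by nlinarith))]
  have hin : ∀ x, 0 ≤ X x → Y x ≤ 0 →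
      (Ici (0 : ℝ)).indicator w (X x) * (Iic (0 : ℝ)).indicator 1 (Y x) = w (X x) :=
    fun x h1 h2 => by simp [h1, h2]
  have hout : ∀ x, ¬ (0 ≤ X x ∧ Y x ≤ 0) →
      F ((Ici (0 : ℝ)).indicator w (X x) * (Iic (0 : ℝ)).indicator 1 (Y x)) = ⊥ := fun x h => by
    rw [not_and_or] at h
    rcases h with h | h <;> simp [h, hF.map_zero]
  refine ⟨fun x _ => ?_, fun x _ y _ l h0 h1 => ?_⟩
  · by_cases h : 0 ≤ X x ∧ Y x ≤ 0
    · simp only [hin x h.1 h.2]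
      exact mem_admInterval_of_le hq (hw _).1 (hw _).2
    · have hz : (Ici (0 : ℝ)).indicator w (X x) * (Iic (0 : ℝ)).indicator 1 (Y x) = 0 := by
        rw [not_and_or] at h
        rcases h with h | h <;> simp [h]
      simp only [hz]
      exact mem_admInterval_of_le hq le_rfl ((hw 0).1.trans (hw 0).2)
  · have h1' : 0 < 1 - l := sub_pos.2 h1
    by_cases hx : 0 ≤ X x ∧ Y x ≤ 0
    swap
    · simp only [hout x hx, EReal.coe_mul_bot_of_pos h1', EReal.bot_add, bot_le]
    by_cases hy : 0 ≤ X y ∧ Y y ≤ 0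
    swap
    · simp only [hout y hy, EReal.coe_mul_bot_of_pos h0, EReal.add_bot, bot_le]
    have hX : X ((1 - l) • x + l • y) = (1 - l) * X x + l * X y := by simp
    have hY : Y ((1 - l) • x + l • y) = (1 - l) * Y x + l * Y y := by simp
    have hX0 : 0 ≤ X ((1 - l) • x + l • y) := by
      rw [hX]; have := mul_nonneg h1'.le hx.1; have := mul_nonneg h0.le hy.1; linarith
    have hY0 : Y ((1 - l) • x + l • y) ≤ 0 := by
      rw [hY]
      have := mul_nonpos_of_nonneg_of_nonpos h1'.le hx.2
      have := mul_nonpos_of_nonneg_of_nonpos h0.le hy.2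
      linarith
    simp only [hin x hx.1 hx.2, hin y hy.1 hy.2, hin _ hX0 hY0, hv _ hx.1, hv _ hy.1, hv _ hX0]
    norm_cast
    rw [hX]
    refine le_min ?_ ?_
    · have := mul_le_mul_of_nonneg_left (min_le_left B (A + X x * (B - A))) h1'.le
      have := mul_le_mul_of_nonneg_left (min_le_left B (A + X y * (B - A))) h0.le
      linarith
    · have := mul_le_mul_of_nonneg_left (min_le_right B (A + X x * (B - A))) h1'.le
      have := mul_le_mul_of_nonneg_left (min_le_right B (A + X y * (B - A))) h0.le
      linarith

/-! ### Assembling the counterexample -/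

theorem mainTheorem5 (n : ℕ) (hn : 2 ≤ n) (a : EReal) (ha : 0 < a) (F : ℝ → EReal)
    (hF : IsAdmissible a F)
    (hnot : ∃ f : EuclideanSpace ℝ (Fin n) → ℝ,
      IsFConcaveOn a F univ f ∧ ¬ IsLogConcaveOn univ f) :
    ∃ φ : EuclideanSpace ℝ (Fin n) → ℝ,
      IsFConcaveOn a F univ φ ∧
      (∃ M : ℝ, ∀ x, φ x ≤ M) ∧
      MemLp φ ⊤ volume ∧
      ∃ T : ℝ, 0 < T ∧ ∀ t : ℝ, 0 < t → t < T → ¬ QuasiconcaveOn ℝ univ (heatFlow n t φ) := by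
  obtain ⟨f, hf, hlog⟩ := hnot
  obtain ⟨p, q, l, hp, hpq, hq, hl0, hl1, hviol⟩ := hF.exists_log_violation hf hlog
  obtain ⟨w, hwc, hw, hFw⟩ := hF.exists_profile hp hpq hq
  have hpa := mem_admInterval_of_le hq hp.le hpq.le
  have hAB : (F p).toReal ≤ (F q).toReal := by
    rw [← EReal.coe_le_coe_iff, hF.coe_toReal hpa hp, hF.coe_toReal hq (hp.trans hpq)]
    exact (hF.strictMonoOn hpa hq hpq).le
  have hw0 : ∀ s, 0 ≤ w s ∧ w s ≤ q := fun s => ⟨hp.le.trans (hw s).1, (hw s).2⟩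
  have hwa : ∀ s, w s ∈ admInterval a := fun s => mem_admInterval_of_le hq (hw0 s).1 (hw0 s).2
  have w0 : w 0 = p := by
    refine hF.strictMonoOn.injOn (hwa 0) hpa ?_
    rw [hFw, ← hF.coe_toReal hpa hp]
    simp [hAB]
  have w1 : w 1 = q := by
    refine hF.strictMonoOn.injOn (hwa 1) hq ?_
    rw [hFw, ← hF.coe_toReal hq (hp.trans hpq)]
    simp [hAB]
  have wl : w l < w 0 ^ (1 - l) * w 1 ^ l := by
    rw [w0, w1]
    refine hviol _ (hwa l) ?_
    rw [hFw, max_eq_right (le_min hAB (by nlinarith)), min_eq_right (by nlinarith)]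
    congr 1
    ring
  -- Move the left point into the interior of the support.
  obtain ⟨ε, hε, hε0⟩ : ∃ ε : ℝ, w ((1 - l) * ε + l * 1) < w ε ^ (1 - l) * w 1 ^ l ∧ 0 < ε := by
    have hc : ContinuousAt (fun ε => w ε ^ (1 - l) * w 1 ^ l - w ((1 - l) * ε + l * 1)) 0 := by
      have h1 : Continuous fun ε : ℝ => w ((1 - l) * ε + l * 1) := by fun_prop
      refine ContinuousAt.sub (ContinuousAt.mul ?_ continuousAt_const) h1.continuousAt
      exact hwc.continuousAt.rpow_const (Or.inl (by rw [w0]; exact hp.ne'))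
    have h2 : ∀ᶠ ε in 𝓝[>] (0 : ℝ), 0 < w ε ^ (1 - l) * w 1 ^ l - w ((1 - l) * ε + l * 1) := by
      refine (hc.tendsto.mono_left nhdsWithin_le_nhds).eventually_const_lt ?_
      simpa using wl
    obtain ⟨ε, h3, h4⟩ := (h2.and self_mem_nhdsWithin).exists
    exact ⟨ε, by linarith, h4⟩
  let i : Fin n := ⟨0, by omega⟩
  let j : Fin n := ⟨1, by omega⟩
  have hij : i ≠ j := by simp [i, j]
  set h : ℝ → ℝ := (Ici (0 : ℝ)).indicator w with hh
  have hm : Measurable h := hwc.measurable.indicator measurableSet_Ici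
  have hb : ∀ s, 0 ≤ h s ∧ h s ≤ q := fun s => by
    by_cases hs : 0 ≤ s
    · simpa [hh, hs] using hw0 s
    · simpa [hh, hs] using (hp.trans hpq).le
  have hb' : ∀ s, |h s| ≤ q := fun s => by rw [abs_of_nonneg (hb s).1]; exact (hb s).2
  have hev : ∀ s, 0 < s → h =ᶠ[𝓝 s] w := fun s hs => by
    filter_upwards [eventually_gt_nhds hs] with x hx
    simp [hh, hx.le]
  set k : ℝ → ℝ := (Iic (0 : ℝ)).indicator 1 with hk
  have hkm : Measurable k := measurable_one.indicator measurableSet_Iic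
  have hkb : ∀ s, 0 ≤ k s ∧ k s ≤ 1 := fun s => by
    by_cases hs : s ≤ 0 <;> simp [hk, hs]
  have hφ : ∀ x : EuclideanSpace ℝ (Fin n), 0 ≤ h (x i) * k (x j) ∧ h (x i) * k (x j) ≤ q :=
    fun x => ⟨mul_nonneg (hb _).1 (hkb _).1,
      (mul_le_of_le_one_right (hb _).1 (hkb _).2).trans (hb _).2⟩
  refine ⟨fun x => h (x i) * k (x j), ?_, ⟨q, fun x => (hφ x).2⟩, ?_, ?_⟩
  · exact isFConcaveOn_profile hF hq hAB hw0 hFw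
      (EuclideanSpace.proj (𝕜 := ℝ) i).toLinearMap (EuclideanSpace.proj (𝕜 := ℝ) j).toLinearMap
  · refine memLp_top_of_bound (C := q) (Measurable.aestronglyMeasurable (by fun_prop))
      (Eventually.of_forall fun x => ?_)
    rw [Real.norm_of_nonneg (hφ x).1]
    exact (hφ x).2
  have hpi : 0 < √Real.pi := Real.sqrt_pos.2 Real.pi_pos
  have hT : ∀ s, 0 < s → Tendsto
      (fun t : ℝ => (2 * √t)⁻¹ * ∫ y, Real.exp (-(s - y) ^ 2 / (4 * t)) * h y) (𝓝[>] 0)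
      (𝓝 (√Real.pi * w s)) := fun s hs => by
    rw [← (hev s hs).eq_of_nhds]
    exact tendsto_heat_line hm hb' (hwc.continuousAt.congr (hev s hs).symm)
  have hm0 : 0 < (1 - l) * ε + l * 1 := by
    have := mul_pos (sub_pos.2 hl1) hε0
    linarith
  have T0 := hT ε hε0
  have T1 := hT 1 one_pos
  have Tm := hT _ hm0
  have hwpos : ∀ s, 0 < √Real.pi * w s := fun s => mul_pos hpi (hp.trans_le (hw s).1)
  have Tr := (T0.rpow_const (p := 1 - l) (Or.inl (hwpos ε).ne')).mul
    (T1.rpow_const (p := l) (Or.inl (hwpos 1).ne'))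
  -- The factor `√π` is harmless: the exponents `1 - l` and `l` add up to `1`.
  have hlt : √Real.pi * w ((1 - l) * ε + l * 1) <
      (√Real.pi * w ε) ^ (1 - l) * (√Real.pi * w 1) ^ l := by
    rw [Real.mul_rpow hpi.le (hw0 _).1, Real.mul_rpow hpi.le (hw0 _).1, mul_mul_mul_comm,
      ← Real.rpow_add hpi, sub_add_cancel, Real.rpow_one]
    exact mul_lt_mul_of_pos_left hε hpi
  -- Only the points `ε`, `1` and their combination determine `T`; the far points `z₀`, `z₁` may
  -- depend on `t`.
  have hsmall := ((Tm.eventually_lt Tr hlt).and (T0.eventually_const_lt (hwpos ε))).and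
    (T1.eventually_const_lt (hwpos 1))
  obtain ⟨T, hT0, hTs⟩ := mem_nhdsGT_iff_exists_Ioo_subset.1 hsmall
  refine ⟨T, hT0, fun t ht htT hquasi => ?_⟩
  obtain ⟨⟨hv, hv0⟩, hv1⟩ := hTs ⟨ht, htT⟩
  obtain ⟨z₀, z₁, r, hr0, hr1, hr⟩ := exists_gaussian_tail_violation ht hv0 hv1 hv
  have hk' : ∀ z : ℝ, ∫ y, Real.exp (-(z - y) ^ 2 / (4 * t)) * k y =
      ∫ y in Iic (0 : ℝ), Real.exp (-(z - y) ^ 2 / (4 * t)) := fun z => by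
    rw [← integral_indicator measurableSet_Iic]
    congr 1
    ext y
    by_cases hy : y ≤ 0 <;> simp [hk, hy]
  let pt : ℝ → ℝ → EuclideanSpace ℝ (Fin n) := fun u z =>
    WithLp.toLp 2 fun m => if m = i then u else if m = j then z else 0
  -- The remaining coordinates are `0` at every test point, so they contribute only to this positive
  -- constant.
  set c : ℝ := (4 * Real.pi * t) ^ (-(n : ℝ) / 2) * (2 * √t) *
    ∏ m ∈ (Finset.univ.erase i).erase j, ∫ y : ℝ, Real.exp (-(0 - y) ^ 2 / (4 * t)) with hcdef
  have hsq : 0 < √t := Real.sqrt_pos.2 ht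
  have hc : 0 < c := by
    refine mul_pos (by positivity) (Finset.prod_pos fun m _ => ?_)
    have : ∀ y : ℝ, Real.exp (-(0 - y) ^ 2 / (4 * t)) = Real.exp (-(4 * t)⁻¹ * y ^ 2) :=
      fun y => by congr 1; ring
    simp_rw [this, integral_gaussian]
    positivity
  have hval : ∀ u z : ℝ, heatFlow n t (fun x => h (x i) * k (x j)) (pt u z) =
      c * (((2 * √t)⁻¹ * ∫ y, Real.exp (-(u - y) ^ 2 / (4 * t)) * h y) *
        ∫ y in Iic (0 : ℝ), Real.exp (-(z - y) ^ 2 / (4 * t))) := fun u z => by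
    have hp0 : ∏ m ∈ (Finset.univ.erase i).erase j,
        ∫ y : ℝ, Real.exp (-(pt u z m - y) ^ 2 / (4 * t)) =
        ∏ m ∈ (Finset.univ.erase i).erase j, ∫ y : ℝ, Real.exp (-(0 - y) ^ 2 / (4 * t)) := by
      refine Finset.prod_congr rfl fun m hm => ?_
      simp only [Finset.mem_erase] at hm
      simp [pt, hm.1, hm.2.1]
    rw [heatFlow_two_factors hij, hp0, hk']
    have hi : pt u z i = u := by simp [pt]
    have hj : pt u z j = z := by simp [pt, hij.symm]
    rw [hi, hj, hcdef]
    have hcancel : ∀ A V K P : ℝ, A * (V * K * P) = A * (2 * √t) * P * ((2 * √t)⁻¹ * V * K) :=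
      fun A V K P => by field_simp
    exact hcancel _ _ _ _
  have hcv := (hquasi (c * r)) (x := pt ε z₀) ⟨mem_univ _, by
      rw [hval]; exact mul_le_mul_of_nonneg_left hr0 hc.le⟩
    (y := pt 1 z₁) ⟨mem_univ _, by rw [hval]; exact mul_le_mul_of_nonneg_left hr1 hc.le⟩
    (sub_pos.2 hl1).le hl0.le (sub_add_cancel 1 l)
  have hpt : (1 - l) • pt ε z₀ + l • pt 1 z₁ =
      pt ((1 - l) * ε + l * 1) ((1 - l) * z₀ + l * z₁) := by
    ext m
    simp only [pt, PiLp.add_apply, PiLp.smul_apply, smul_eq_mul]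
    split_ifs <;> ring
  rw [hpt] at hcv
  have := hcv.2
  rw [hval] at this
  exact absurd (le_of_mul_le_mul_left this hc) (not_le.2 hr)
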